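/- Call a lattice homomorphism $f\colon K\to L$ \emph{lower bounded} if for every $y\in L$ the preimage $f^{-1}(y)$ has a least element, and call a lattice \emph{lower bounded} if it is the image of a finitely generated free lattice under a (surjective) lower bounded homomorphism. For $n\ge 0$ and $Y\subseteq\mathbb{R}^n$ let $\mathrm{Co}(Y)$ denote the convex hull of $Y$. Let $\mathrm{Co}(\mathbb{R}^n)$ be the lattice of all convex subsets of $\mathbb{R}^n$ ordered by inclusion and, for $X\subseteq\mathbb{R}^n$, let \[ \mathrm{Co}(\mathbb{R}^n,X)=\{\,Y\subseteq\mathbb{R}^n : Y=\mathrm{Co}(Y)\cap X\,\} \] be the lattice, ordered by inclusion, of convex sets relative to $X$. \textbf{Theorem.} For every finite lower bounded lattice $L$ there are an integer $n\ge 0$ and a finite set $X\subseteq\mathbb{R}^n$ such that the lattice $\mathrm{Co}(\mathbb{R}^n,X)$ is lower bounded and $L$ embeds, by injective maps preserving binary joins and meets, both into $\mathrm{Co}(\mathbb{R}^n)$ and into $\mathrm{Co}(\mathbb{R}^n,X)$. -/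

import Mathlib

universe u v

/-- Lattice terms (words in join and meet) over an alphabet `α`. -/
inductive LatticeTerm (α : Type u) : Type u
  | var : α → LatticeTerm α
  | sup : LatticeTerm α → LatticeTerm α → LatticeTerm α
  | inf : LatticeTerm α → LatticeTerm α → LatticeTerm α

namespace LatticeTerm

variable {α : Type u}

/-- The inequalities between terms that follow from the axioms of lattice theory. -/
inductive Le : LatticeTerm α → LatticeTerm α → Prop
  | refl (a : LatticeTerm α) : Le a a
  | trans {a b c : LatticeTerm α} : Le a b → Le b c → Le a c
  | le_sup_left (a b : LatticeTerm α) : Le a (sup a b)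
  | le_sup_right (a b : LatticeTerm α) : Le b (sup a b)
  | sup_le {a b c : LatticeTerm α} : Le a c → Le b c → Le (sup a b) c
  | inf_le_left (a b : LatticeTerm α) : Le (inf a b) a
  | inf_le_right (a b : LatticeTerm α) : Le (inf a b) b
  | le_inf {a b c : LatticeTerm α} : Le a b → Le a c → Le a (inf b c)

instance : Preorder (LatticeTerm α) where
  le := Le
  le_refl := Le.refl
  le_trans _ _ _ := Le.trans

/-- The value of a term in a lattice under an assignment of the variables. -/
def eval {M : Type v} [Lattice M] (f : α → M) : LatticeTerm α → M
  | var a => f a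
  | sup s t => eval f s ⊔ eval f t
  | inf s t => eval f s ⊓ eval f t

theorem eval_mono {M : Type v} [Lattice M] (f : α → M) : Monotone (eval f) := by
  intro s t h
  change Le s t at h
  induction h with
  | refl a => exact le_rfl
  | trans _ _ h₁ h₂ => exact h₁.trans h₂
  | le_sup_left a b => exact _root_.le_sup_left
  | le_sup_right a b => exact _root_.le_sup_right
  | sup_le _ _ h₁ h₂ => exact _root_.sup_le h₁ h₂
  | inf_le_left a b => exact _root_.inf_le_left
  | inf_le_right a b => exact _root_.inf_le_right
  | le_inf _ _ h₁ h₂ => exact _root_.le_inf h₁ h₂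

end LatticeTerm

/-- The free lattice on `α`: lattice terms modulo provable equality. -/
def FreeLattice (α : Type u) : Type u :=
  Antisymmetrization (LatticeTerm α) (· ≤ ·)

namespace FreeLattice

variable {α : Type u}

/-- The element of the free lattice represented by a term. -/
def mk (t : LatticeTerm α) : FreeLattice α :=
  toAntisymmetrization (· ≤ ·) t

/-- The free generators. -/
def of (a : α) : FreeLattice α := mk (LatticeTerm.var a)

instance : PartialOrder (FreeLattice α) :=
  inferInstanceAs (PartialOrder (Antisymmetrization (LatticeTerm α) (· ≤ ·)))

theorem mk_le_mk {s t : LatticeTerm α} : mk s ≤ mk t ↔ s ≤ t := Iff.rfl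

theorem mk_surjective : Function.Surjective (mk : LatticeTerm α → FreeLattice α) :=
  Quotient.mk_surjective

instance : Lattice (FreeLattice α) where
  sup := Quotient.map₂ LatticeTerm.sup fun _ _ h₁ _ _ h₂ =>
    ⟨.sup_le (.trans h₁.1 (.le_sup_left _ _)) (.trans h₂.1 (.le_sup_right _ _)),
      .sup_le (.trans h₁.2 (.le_sup_left _ _)) (.trans h₂.2 (.le_sup_right _ _))⟩
  inf := Quotient.map₂ LatticeTerm.inf fun _ _ h₁ _ _ h₂ =>
    ⟨.le_inf (.trans (.inf_le_left _ _) h₁.1) (.trans (.inf_le_right _ _) h₂.1),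
      .le_inf (.trans (.inf_le_left _ _) h₁.2) (.trans (.inf_le_right _ _) h₂.2)⟩
  le_sup_left := by rintro ⟨a⟩ ⟨b⟩; exact LatticeTerm.Le.le_sup_left a b
  le_sup_right := by rintro ⟨a⟩ ⟨b⟩; exact LatticeTerm.Le.le_sup_right a b
  sup_le := by rintro ⟨a⟩ ⟨b⟩ ⟨c⟩ h₁ h₂; exact LatticeTerm.Le.sup_le h₁ h₂
  inf_le_left := by rintro ⟨a⟩ ⟨b⟩; exact LatticeTerm.Le.inf_le_left a b
  inf_le_right := by rintro ⟨a⟩ ⟨b⟩; exact LatticeTerm.Le.inf_le_right a b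
  le_inf := by rintro ⟨a⟩ ⟨b⟩ ⟨c⟩ h₁ h₂; exact LatticeTerm.Le.le_inf h₁ h₂

theorem mk_sup (s t : LatticeTerm α) : mk (s.sup t) = mk s ⊔ mk t := rfl

theorem mk_inf (s t : LatticeTerm α) : mk (s.inf t) = mk s ⊓ mk t := rfl

/-- The universal property of the free lattice. -/
theorem existsUnique_lift {M : Type v} [Lattice M] (f : α → M) :
    ∃! g : LatticeHom (FreeLattice α) M, ∀ a, g (of a) = f a := by
  refine ⟨{ toFun := Quotient.lift (LatticeTerm.eval f) fun s t h =>
              le_antisymm (LatticeTerm.eval_mono f h.1) (LatticeTerm.eval_mono f h.2)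
            map_sup' := by rintro ⟨s⟩ ⟨t⟩; rfl
            map_inf' := by rintro ⟨s⟩ ⟨t⟩; rfl }, fun a => rfl, ?_⟩
  intro g hg
  ext x
  obtain ⟨t, rfl⟩ := mk_surjective x
  change g (mk t) = LatticeTerm.eval f t
  induction t with
  | var a => exact hg a
  | sup s t hs ht => rw [mk_sup, map_sup, hs, ht]; rfl
  | inf s t hs ht => rw [mk_inf, map_inf, hs, ht]; rfl

end FreeLattice

/-- A lattice homomorphism is lower bounded if
the preimage of every element has a least element. -/
def IsLowerBoundedHom {K : Type u} {L : Type v} [Lattice K] [Lattice L]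
    (f : LatticeHom K L) : Prop :=
  ∀ y : L, ∃ x : K, IsLeast (f ⁻¹' {y}) x

/-- A lattice is lower bounded if it is the image of a finitely generated free lattice under a
lower bounded homomorphism. -/
def IsLowerBoundedLattice (L : Type u) [Lattice L] : Prop :=
  ∃ (k : ℕ) (f : LatticeHom (FreeLattice (Fin k)) L),
    Function.Surjective f ∧ IsLowerBoundedHom f

/-- `L` embeds into `M` as a lattice: some injective map preserves binary joins and meets. -/
def LatticeEmbeds (L : Type u) (M : Type v) [Lattice L] [Lattice M] : Prop :=
  ∃ f : LatticeHom L M, Function.Injective f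

/-- `Co(E)`: the convex subsets of a real vector space `E`, ordered by inclusion. -/
def Co (E : Type u) [AddCommGroup E] [Module ℝ E] : Type u :=
  {Y : Set E // Convex ℝ Y}

namespace Co

variable {E : Type u} [AddCommGroup E] [Module ℝ E]

instance : PartialOrder (Co E) := inferInstanceAs (PartialOrder {Y : Set E // Convex ℝ Y})

/-- Meet is intersection, join is the convex hull of the union. -/
instance : Lattice (Co E) where
  sup A B := ⟨convexHull ℝ (A.1 ∪ B.1), convex_convexHull ℝ _⟩
  inf A B := ⟨A.1 ∩ B.1, A.2.inter B.2⟩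
  le_sup_left _ _ := Set.subset_union_left.trans (subset_convexHull ℝ _)
  le_sup_right _ _ := Set.subset_union_right.trans (subset_convexHull ℝ _)
  sup_le _ _ C h₁ h₂ := convexHull_min (Set.union_subset h₁ h₂) C.2
  inf_le_left _ _ := Set.inter_subset_left
  inf_le_right _ _ := Set.inter_subset_right
  le_inf _ _ _ h₁ h₂ := Set.subset_inter h₁ h₂

end Co

/-- `Co(E, X)`: the sets `Y` with `Y = Co(Y) ∩ X`, the convex sets relative to `X`, ordered by
inclusion. -/
def RelCo (E : Type u) [AddCommGroup E] [Module ℝ E] (X : Set E) : Type u :=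
  {Y : Set E // Y = convexHull ℝ Y ∩ X}

namespace RelCo

variable {E : Type u} [AddCommGroup E] [Module ℝ E] {X : Set E}

instance : PartialOrder (RelCo E X) :=
  inferInstanceAs (PartialOrder {Y : Set E // Y = convexHull ℝ Y ∩ X})

theorem subset (A : RelCo E X) : A.1 ⊆ X := fun _ hx => (A.2.subset hx).2

theorem convexHull_inter_mem (Z : Set E) :
    convexHull ℝ Z ∩ X = convexHull ℝ (convexHull ℝ Z ∩ X) ∩ X := by
  apply Set.Subset.antisymm
  · exact Set.subset_inter (subset_convexHull ℝ _) Set.inter_subset_right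
  · exact Set.inter_subset_inter_left X
      (convexHull_min Set.inter_subset_left (convex_convexHull ℝ Z))

theorem inter_mem (A B : RelCo E X) : A.1 ∩ B.1 = convexHull ℝ (A.1 ∩ B.1) ∩ X := by
  apply Set.Subset.antisymm
  · exact Set.subset_inter (subset_convexHull ℝ _) (Set.inter_subset_left.trans A.subset)
  · rintro x ⟨hx, hX⟩
    exact ⟨A.2.superset ⟨convexHull_mono Set.inter_subset_left hx, hX⟩,
      B.2.superset ⟨convexHull_mono Set.inter_subset_right hx, hX⟩⟩

/-- Meet is intersection, join is the trace on `X` of the convex hull of the union. -/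
instance : Lattice (RelCo E X) where
  sup A B := ⟨convexHull ℝ (A.1 ∪ B.1) ∩ X,
    convexHull_inter_mem _⟩
  inf A B := ⟨A.1 ∩ B.1, inter_mem A B⟩
  le_sup_left A _ := Set.subset_inter
    (Set.subset_union_left.trans (subset_convexHull ℝ _)) A.subset
  le_sup_right _ B := Set.subset_inter
    (Set.subset_union_right.trans (subset_convexHull ℝ _)) B.subset
  sup_le _ _ C h₁ h₂ := fun _ hx =>
    C.2.superset ⟨convexHull_mono (Set.union_subset h₁ h₂) hx.1, hx.2⟩
  inf_le_left _ _ := Set.inter_subset_left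
  inf_le_right _ _ := Set.inter_subset_right
  le_inf _ _ _ h₁ h₂ := Set.subset_inter h₁ h₂

end RelCo

/-! ### Cuts through lattice terms -/

namespace LatticeTerm

variable {α : Type u}

/-! Lower boundedness of a finite lattice is turned into a rank that drops along minimal nontrivial
join covers (`IsLowerBoundedLattice.exists_rank`). Conversely, `isLowerBoundedLattice_of_rank`
recovers lower boundedness from such a rank on join generators.

Because ranks drop, the covers of `L` unfold into a finite forest (`exists_labelled_blocks`): a node
carries an element of `L`, and every minimal cover of that element contributes its own block of
children. Copying elements in this way makes the blocks disjoint.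

The nodes become points of the quotient of `T → ℝ` by the relations "head = barycenter of its
children" (`exists_configuration`). The crux, `exists_common_combination`, is that hulls of
block-closed sets meet only in the hull of the intersection.

An element `a` is sent to the points with label below `a`, or to their hull. Joins survive because
heads lie in the hull of their children, meets because of the intersection property. Injectivity
holds because the hull of the points of a closed set contains the point of no other node. The same
rank on nodes shows that the relatively convex sets form a lower bounded lattice. -/

/-- The number of symbols of a term. -/
def size : LatticeTerm α → ℕ
  | var _ => 1
  | sup s t => size s + size t + 1
  | inf s t => size s + size t + 1

/-- `CutBelow Q s` says that descending from `s` through both sides of joins and through one side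
of meets one can reach subterms that satisfy `Q`. -/
def CutBelow (Q : LatticeTerm α → Prop) : LatticeTerm α → Prop
  | var x => Q (var x)
  | sup s t => Q (sup s t) ∨ (CutBelow Q s ∧ CutBelow Q t)
  | inf s t => Q (inf s t) ∨ (CutBelow Q s ∨ CutBelow Q t)

theorem CutBelow.of_self {Q : LatticeTerm α → Prop} {s : LatticeTerm α} (h : Q s) :
    CutBelow Q s := by
  cases s with
  | var x => exact h
  | sup s t => exact Or.inl h
  | inf s t => exact Or.inl h

/-- Each axiom of `Le` respects cuts and transitivity is composition, so neither normal forms nor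
Whitman's condition are needed. -/
theorem CutBelow.anti {Q : LatticeTerm α → Prop} (hQ : ∀ s t, s ≤ t → Q t → Q s)
    {s t : LatticeTerm α} (hst : s ≤ t) : CutBelow Q t → CutBelow Q s := by
  change Le s t at hst
  induction hst with
  | refl a => exact id
  | trans _ _ h₁ h₂ => exact fun h => h₁ (h₂ h)
  | le_sup_left a b =>
    rintro (h | h)
    · exact .of_self (hQ _ _ (Le.le_sup_left a b) h)
    · exact h.1
  | le_sup_right a b =>
    rintro (h | h)
    · exact .of_self (hQ _ _ (Le.le_sup_right a b) h)
    · exact h.2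
  | sup_le _ _ h₁ h₂ => exact fun h => Or.inr ⟨h₁ h, h₂ h⟩
  | inf_le_left a b => exact fun h => Or.inr (Or.inl h)
  | inf_le_right a b => exact fun h => Or.inr (Or.inr h)
  | le_inf h₁ h₂ ih₁ ih₂ =>
    rintro (h | h | h)
    · exact .of_self (hQ _ _ (Le.le_inf h₁ h₂) h)
    · exact ih₁ h
    · exact ih₂ h

end LatticeTerm

/-! ### Minimal join covers -/

section Covers

variable {L : Type u} [Lattice L]

/-- Every upper bound of `S` lies above `a`. -/
def IsCover (a : L) (S : Set L) : Prop := ∀ u ∈ upperBounds S, a ≤ u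

/-- `C` is a nontrivial join cover of `a` that is contained in every join cover refining it. -/
structure IsMinimalCover (a : L) (C : Set L) : Prop where
  isCover : IsCover a C
  not_le : ∀ c ∈ C, ¬ a ≤ c
  nonempty : C.Nonempty
  subset : ∀ V : Set L, (∀ v ∈ V, ∃ c ∈ C, v ≤ c) → IsCover a V → C ⊆ V

/-- A one-element cover would be trivial. Hence blocks will have two children, which makes
singletons block-closed. -/
theorem IsMinimalCover.exists_ne {a : L} {C : Set L} (h : IsMinimalCover a C) {c : L} :
    ∃ d ∈ C, d ≠ c := by
  by_contra! hc
  obtain ⟨d, hd⟩ := h.nonempty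
  exact h.not_le d hd (h.isCover d fun x hx => by rw [hc x hx, hc d hd])

theorem IsMinimalCover.eq_of_le {a : L} {C : Set L} (h : IsMinimalCover a C) {c d : L}
    (hc : c ∈ C) (hd : d ∈ C) (hcd : c ≤ d) : c = d := by
  by_contra hne
  refine (h.subset (C \ {c}) (fun v hv => ⟨v, hv.1, le_rfl⟩) ?_ hc).2 rfl
  intro u hu
  refine h.isCover u fun x hx => ?_
  by_cases hxc : x = c
  · exact hxc ▸ hcd.trans (hu ⟨hd, fun h => hne h.symm⟩)
  · exact hu ⟨hx, hxc⟩

/-- Take a minimal lower set `D` refining `{b, c}` and covering `a`. Its maximal elements work: any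
cover refining them generates a lower set inside `D`, hence all of `D`. -/
theorem exists_isMinimalCover [Finite L] {a b c : L} (h : a ≤ b ⊔ c) (hb : ¬ a ≤ b)
    (hc : ¬ a ≤ c) : ∃ C, IsMinimalCover a C ∧ ∀ x ∈ C, x ≤ b ∨ x ≤ c := by
  obtain ⟨D, hD⟩ := (Set.toFinite {D : Set L | IsCover a D ∧ IsLowerSet D ∧
    ∀ x ∈ D, x ≤ b ∨ x ≤ c}).exists_minimal
      ⟨{x | x ≤ b ∨ x ≤ c},
        fun u hu => h.trans (sup_le (hu (Or.inl le_rfl)) (hu (Or.inr le_rfl))),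
        fun x y hyx hx => hx.imp hyx.trans hyx.trans, fun x hx => hx⟩
  obtain ⟨⟨hcov, hlow, hDb⟩, hmin⟩ := hD
  have hC : IsCover a {x | Maximal (· ∈ D) x} := by
    intro u hu
    refine hcov u fun x hx => ?_
    obtain ⟨y, hxy, hy⟩ := (Set.toFinite D).exists_le_maximal hx
    exact hxy.trans (hu hy)
  refine ⟨{x | Maximal (· ∈ D) x}, ⟨hC, ?_, ?_, ?_⟩, fun x hx => hDb x hx.1⟩
  · intro x hx hax
    exact (hDb x hx.1).elim (fun h => hb (hax.trans h)) fun h => hc (hax.trans h)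
  · by_contra hne
    rw [Set.not_nonempty_iff_eq_empty] at hne
    rw [hne] at hC
    exact hb (hC b (by simp))
  · intro V hV hVa x hx
    have hVD : ∀ v ∈ V, v ∈ D := fun v hv => by
      obtain ⟨y, hy, hvy⟩ := hV v hv
      exact hlow hvy hy.1
    have hsub : (lowerClosure V : Set L) ⊆ D := by
      rintro y ⟨v, hv, hyv⟩
      exact hlow hyv (hVD v hv)
    obtain ⟨v, hv, hxv⟩ := hmin (y := (lowerClosure V : Set L))
      ⟨fun u hu => hVa u fun v hv => hu (subset_lowerClosure hv), (lowerClosure V).lower,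
        fun x hx => hDb x (hsub hx)⟩ hsub hx.1
    rwa [le_antisymm hxv (hx.2 (hVD v hv) hxv)]

end Covers

/-! ### From lower boundedness to a rank -/

section RankOfLowerBounded

variable {L : Type u} [Lattice L]

open LatticeTerm FreeLattice

/-- A term lies below the join of the subterms reached by a cut. The strict drop in size is what
makes the rank decrease. -/
theorem LatticeTerm.CutBelow.exists_cut {α : Type v} (f : LatticeHom (FreeLattice α) L)
    {Q : LatticeTerm α → Prop} {s : LatticeTerm α} (h : CutBelow Q s) :
    Q s ∨ ∃ V : Set (LatticeTerm α), (∀ t ∈ V, Q t ∧ size t < size s) ∧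
      IsCover (f (mk s)) ((fun t => f (mk t)) '' V) := by
  have weak : ∀ s : LatticeTerm α, (Q s ∨ ∃ V : Set (LatticeTerm α),
      (∀ t ∈ V, Q t ∧ size t < size s) ∧ IsCover (f (mk s)) ((fun t => f (mk t)) '' V)) →
      ∃ V : Set (LatticeTerm α), (∀ t ∈ V, Q t ∧ size t ≤ size s) ∧
        IsCover (f (mk s)) ((fun t => f (mk t)) '' V) := by
    rintro s (h | ⟨V, hV, hc⟩)
    · exact ⟨{s}, by simpa using h, fun u hu => hu (by simp)⟩
    · exact ⟨V, fun t ht => ⟨(hV t ht).1, (hV t ht).2.le⟩, hc⟩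
  induction s with
  | var x => exact Or.inl h
  | sup s t hs ht =>
    rcases h with h | ⟨h₁, h₂⟩
    · exact Or.inl h
    obtain ⟨V, hV, hVc⟩ := weak s (hs h₁)
    obtain ⟨W, hW, hWc⟩ := weak t (ht h₂)
    refine Or.inr ⟨V ∪ W, ?_, ?_⟩
    · rintro x (hx | hx)
      · exact ⟨(hV x hx).1, (hV x hx).2.trans_lt (by simp only [size]; lia)⟩
      · exact ⟨(hW x hx).1, (hW x hx).2.trans_lt (by simp only [size]; lia)⟩
    · intro u hu
      rw [mk_sup, map_sup]
      rw [Set.image_union, upperBounds_union] at hu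
      exact sup_le (hVc u hu.1) (hWc u hu.2)
  | inf s t hs ht =>
    rcases h with h | h | h
    · exact Or.inl h
    · obtain ⟨V, hV, hVc⟩ := weak s (hs h)
      refine Or.inr ⟨V, fun x hx => ⟨(hV x hx).1, (hV x hx).2.trans_lt ?_⟩, fun u hu => ?_⟩
      · simp only [size]; lia
      · rw [mk_inf, map_inf]
        exact inf_le_left.trans (hVc u hu)
    · obtain ⟨V, hV, hVc⟩ := weak t (ht h)
      refine Or.inr ⟨V, fun x hx => ⟨(hV x hx).1, (hV x hx).2.trans_lt ?_⟩, fun u hu => ?_⟩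
      · simp only [size]; lia
      · rw [mk_inf, map_inf]
        exact inf_le_right.trans (hVc u hu)

theorem exists_term_above {α : Type v} (f : LatticeHom (FreeLattice α) L)
    {Q : LatticeTerm α → Prop} {C : Set L} (hC : C.Finite) (hne : C.Nonempty)
    (hQ : ∀ c ∈ C, ∃ s, Q s ∧ c ≤ f (mk s)) :
    ∃ s, CutBelow Q s ∧ ∀ c ∈ C, c ≤ f (mk s) := by
  induction C, hC using Set.Finite.induction_on with
  | empty => exact absurd hne Set.not_nonempty_empty
  | @insert c C _ _ ih =>
    obtain ⟨s, hs, hcs⟩ := hQ c (Set.mem_insert _ _)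
    rcases C.eq_empty_or_nonempty with rfl | hCne
    · exact ⟨s, .of_self hs, by simpa using hcs⟩
    · obtain ⟨t, ht, htC⟩ := ih hCne fun d hd => hQ d (Set.mem_insert_of_mem _ hd)
      refine ⟨sup s t, Or.inr ⟨.of_self hs, ht⟩, ?_⟩
      rw [mk_sup, map_sup]
      rintro d (rfl | hd)
      · exact hcs.trans le_sup_left
      · exact (htC d hd).trans le_sup_right

/-- In a finite lower bounded lattice some rank function strictly decreases from an element to the
members of its minimal nontrivial join covers. -/
theorem IsLowerBoundedLattice.exists_rank [Finite L] (hL : IsLowerBoundedLattice L) :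
    ∃ r : L → ℕ, ∀ a C, IsMinimalCover a C → ∀ c ∈ C, r c < r a := by
  obtain ⟨k, f, hf, hlb⟩ := hL
  choose m hm using hlb
  have hex : ∀ a, ∃ s : LatticeTerm (Fin k), mk s = m a ∧ ∀ t, mk t = m a → size s ≤ size t := by
    intro a
    obtain ⟨s, hs, hmin⟩ := exists_minimalFor_of_wellFoundedLT
      (fun s : LatticeTerm (Fin k) => mk s = m a) size (mk_surjective _)
    exact ⟨s, hs, fun t ht => (le_total (size s) (size t)).elim id fun h => hmin ht h⟩
  choose β hβ hsize using hex
  have hfβ : ∀ a, f (mk (β a)) = a := fun a => by rw [hβ]; exact (hm a).1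
  have hleast : ∀ a s, a ≤ f (mk s) → mk (β a) ≤ mk s := by
    intro a s h
    have : m a ≤ mk s ⊓ m a := (hm a).2 (by
      change f (mk s ⊓ m a) = a
      rw [map_inf, ← hβ, hfβ]
      exact inf_eq_right.2 h)
    rw [hβ]
    exact this.trans inf_le_left
  -- The rank of `a` is the size of a shortest term for the least preimage of `a`.
  refine ⟨fun a => size (β a), fun a C hC c hc => ?_⟩
  let Q : LatticeTerm (Fin k) → Prop := fun s => ∃ d ∈ C, mk s ≤ mk (β d)
  obtain ⟨T, hT, hCT⟩ := exists_term_above f (Q := Q) (Set.toFinite C) hC.nonempty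
    fun d hd => ⟨β d, ⟨d, hd, le_rfl⟩, (hfβ d).ge⟩
  have hcut : CutBelow Q (β a) := by
    refine CutBelow.anti ?_ (mk_le_mk.1 (hleast a T (hC.isCover _ fun d hd => hCT d hd))) hT
    rintro s t hst ⟨d, hd, h⟩
    exact ⟨d, hd, (mk_le_mk.2 hst).trans h⟩
  have hmono : ∀ s d, mk s ≤ mk (β d) → f (mk s) ≤ d := fun s d h => by
    have := OrderHomClass.mono f h
    rwa [hfβ] at this
  rcases hcut.exists_cut f with ⟨d, hd, h⟩ | ⟨V, hV, hcov⟩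
  · exact absurd (hfβ a ▸ hmono _ d h) (hC.not_le d hd)
  · rw [hfβ] at hcov
    -- The cut refines `C`, so minimality exhibits `c` as the image of some `s` in it. As `s` is
    -- below `β c`, it represents `m c`, and it is shorter than `β a`.
    obtain ⟨s, hs, hsc⟩ := hC.subset _ (by
      rintro _ ⟨s, hs, rfl⟩
      obtain ⟨d, hd, h⟩ := (hV s hs).1
      exact ⟨d, hd, hmono s d h⟩) hcov hc
    obtain ⟨⟨d, hd, h⟩, hlt⟩ := hV s hs
    have hcd : c = d := hC.eq_of_le hc hd (hsc ▸ hmono s d h)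
    subst hcd
    exact (hsize c s ((h.antisymm (hleast c s hsc.ge)).trans (hβ c))).trans_lt hlt

end RankOfLowerBounded

/-! ### From a rank to lower boundedness -/

section LowerBoundedOfRank

variable {M : Type u} [Lattice M]

open LatticeTerm FreeLattice

theorem FreeLattice.induction_on {α : Type u} {P : FreeLattice α → Prop} (w : FreeLattice α)
    (of : ∀ a, P (of a)) (sup : ∀ v w, P v → P w → P (v ⊔ w))
    (inf : ∀ v w, P v → P w → P (v ⊓ w)) : P w := by
  obtain ⟨t, rfl⟩ := mk_surjective w
  induction t with
  | var a => exact of a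
  | sup s t hs ht => exact sup _ _ hs ht
  | inf s t hs ht => exact inf _ _ hs ht

/-- A finite lattice is lower bounded if it is join generated by a family of ranked elements such
that every nontrivial binary join cover of a member refines to a cover by members of smaller
rank. -/
theorem isLowerBoundedLattice_of_rank [Finite M] [Nonempty M] {P : Type v} [Finite P] (ι : P → M)
    (r : P → ℕ) (dense : ∀ a b : M, (∀ p, ι p ≤ a → ι p ≤ b) → a ≤ b)
    (cover : ∀ p a b, ι p ≤ a ⊔ b → ¬ ι p ≤ a → ¬ ι p ≤ b →
      ∃ S : Set P, (∀ q ∈ S, r q < r p ∧ (ι q ≤ a ∨ ι q ≤ b)) ∧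
        ∀ u, (∀ q ∈ S, ι q ≤ u) → ι p ≤ u) :
    IsLowerBoundedLattice M := by
  classical
  obtain ⟨k, ⟨e⟩⟩ := Finite.exists_equiv_fin M
  obtain ⟨f, hf, -⟩ := existsUnique_lift (fun i => e.symm i)
  have hgen : ∀ a : M, f (of (e a)) = a := fun a => by rw [hf]; simp
  have bot : ∃ b : FreeLattice (Fin k), ∀ w, b ≤ w := by
    cases nonempty_fintype M
    refine ⟨Finset.univ.inf' Finset.univ_nonempty fun a : M => of (e a), fun w => ?_⟩
    induction w using FreeLattice.induction_on with
    | of i => exact (Finset.inf'_le _ (Finset.mem_univ (e.symm i))).trans (by simp)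
    | sup v w hv hw => exact hv.trans le_sup_left
    | inf v w hv hw => exact le_inf hv hw
  obtain ⟨b₀, hb₀⟩ := bot
  have key : ∀ n p, r p = n → ∃ w, ι p ≤ f w ∧ ∀ v, ι p ≤ f v → w ≤ v := by
    intro n
    induction n using Nat.strong_induction_on with
    | _ n ih =>
    intro p hp
    -- Only the values of `v₁` and `v₂` in the finite lattice `M` matter, so finitely many elements,
    -- one per pair, handle all joins. Pairs that are not nontrivial covers receive a harmless
    -- default.
    have hpair : ∀ c : M × M, ∃ w, ι p ≤ f w ∧ ∀ v₁ v₂, f v₁ = c.1 → f v₂ = c.2 →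
        ι p ≤ c.1 ⊔ c.2 → ¬ ι p ≤ c.1 → ¬ ι p ≤ c.2 → w ≤ v₁ ⊔ v₂ := by
      rintro ⟨a, b⟩
      by_cases h : ι p ≤ a ⊔ b ∧ ¬ ι p ≤ a ∧ ¬ ι p ≤ b
      · obtain ⟨S, hS, hcov⟩ := cover p a b h.1 h.2.1 h.2.2
        have hlow : ∀ q ∈ S, ∃ w, ι q ≤ f w ∧ ∀ v, ι q ≤ f v → w ≤ v := fun q hq =>
          ih (r q) (hp ▸ (hS q hq).1) q rfl
        have : Nonempty (FreeLattice (Fin k)) := ⟨b₀⟩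
        choose! w hw hmin using hlow
        have hfin := Set.toFinite S
        -- The bottom `b₀` only keeps the finite join nonempty.
        refine ⟨(insert b₀ (hfin.toFinset.image w)).sup' (Finset.insert_nonempty _ _) id,
          ?_, ?_⟩
        · refine hcov _ fun q hq => (hw q hq).trans (OrderHomClass.mono f ?_)
          exact Finset.le_sup' id (by simp; exact Or.inr ⟨q, hq, rfl⟩)
        · intro v₁ v₂ h₁ h₂ _ _ _
          refine Finset.sup'_le _ _ fun x hx => ?_
          simp only [Finset.mem_insert, Finset.mem_image, Set.Finite.mem_toFinset] at hx
          rcases hx with rfl | ⟨q, hq, rfl⟩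
          · exact hb₀ _
          · rcases (hS q hq).2 with h' | h'
            · exact (hmin q hq v₁ (h₁ ▸ h')).trans le_sup_left
            · exact (hmin q hq v₂ (h₂ ▸ h')).trans le_sup_right
      · exact ⟨of (e (ι p)), (hgen _).ge, fun _ _ _ _ h₁ h₂ h₃ => absurd ⟨h₁, h₂, h₃⟩ h⟩
    choose g hg hgmin using hpair
    cases nonempty_fintype M
    have hne : (Finset.univ.filter fun a : M => ι p ≤ a).Nonempty := ⟨ι p, by simp⟩
    -- In the induction on `v`, the first factor serves nontrivial joins and the second serves
    -- generators.
    refine ⟨(Finset.univ.inf' Finset.univ_nonempty g) ⊓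
      (Finset.univ.filter fun a : M => ι p ≤ a).inf' hne fun a => of (e a), ?_, ?_⟩
    · rw [map_inf, map_finset_inf', map_finset_inf']
      refine le_inf (Finset.le_inf' _ _ fun c _ => hg c) (Finset.le_inf' _ _ fun a ha => ?_)
      simpa [hgen] using ha
    · intro v hv
      induction v using FreeLattice.induction_on with
      | of i =>
        refine inf_le_right.trans ((Finset.inf'_le _ (b := f (of i)) (by simpa using hv)).trans ?_)
        simp [hf]
      | sup v w hv' hw' =>
        by_cases h₁ : ι p ≤ f v
        · exact (hv' h₁).trans le_sup_left
        by_cases h₂ : ι p ≤ f w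
        · exact (hw' h₂).trans le_sup_right
        rw [map_sup] at hv
        exact inf_le_left.trans ((Finset.inf'_le _ (Finset.mem_univ (f v, f w))).trans
          (hgmin (f v, f w) v w rfl rfl hv h₁ h₂))
      | inf v w hv' hw' =>
        rw [map_inf] at hv
        exact le_inf (hv' (hv.trans inf_le_left)) (hw' (hv.trans inf_le_right))
  choose w hw hmin using fun p => key (r p) p rfl
  refine ⟨k, f, fun a => ⟨_, hgen a⟩, fun y => ?_⟩
  have hfin := Set.toFinite {p | ι p ≤ y}
  have hle : ∀ v, y ≤ f v →
      (insert b₀ (hfin.toFinset.image w)).sup' (Finset.insert_nonempty _ _) id ≤ v := by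
    intro v hv
    refine Finset.sup'_le _ _ fun x hx => ?_
    simp only [Finset.mem_insert, Finset.mem_image, Set.Finite.mem_toFinset] at hx
    rcases hx with rfl | ⟨q, hq, rfl⟩
    · exact hb₀ _
    · exact hmin q v (le_trans hq hv)
  refine ⟨_, le_antisymm ?_ ?_, fun v hv => hle v (Eq.ge hv)⟩
  · exact (OrderHomClass.mono f (hle (of (e y)) (hgen y).ge)).trans (hgen y).le
  · refine dense _ _ fun p hp => (hw p).trans (OrderHomClass.mono f ?_)
    exact Finset.le_sup' id (by simp; exact Or.inr ⟨p, hp, rfl⟩)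

end LowerBoundedOfRank

/-! ### Points with prescribed barycenters -/

section Configuration

variable {T : Type u} {I : Type v} (head : I → T) (ch : I → Finset T)

/-- The relation making the head of a block the barycenter of its children. -/
noncomputable def blockRelation [DecidableEq T] (i : I) : T → ℝ :=
  fun t => (if t = head i then ((ch i).card : ℝ) else 0) - if t ∈ ch i then 1 else 0

/-- A set of nodes is closed under the blocks in `J` if it contains the head of every block whose
children it contains. -/
def BlockClosed (J : Set I) (A : Set T) : Prop :=
  ∀ i ∈ J, (∀ c ∈ ch i, c ∈ A) → head i ∈ A

variable {head ch}

/-- Two weightings with the same image are replaced by one supported on both sets. Blocks are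
eliminated from the lowest head upwards by moving the uniform part of the children's weight to the
head. -/
theorem exists_common_combination [DecidableEq T] (r : T → ℕ)
    (hr : ∀ i, ∀ c ∈ ch i, r c < r (head i)) (hne : ∀ i, (ch i).Nonempty)
    (hdis : ∀ i j c, c ∈ ch i → c ∈ ch j → i = j)
    (J : Finset I) : ∀ (A B : Set T), BlockClosed head ch J A → BlockClosed head ch J B →
    ∀ α β : T → ℝ, (∀ t, 0 ≤ α t) → (∀ t, 0 ≤ β t) → (∀ t ∉ A, α t = 0) → (∀ t ∉ B, β t = 0) →
    α - β ∈ Submodule.span ℝ (blockRelation head ch '' J) →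
    ∃ γ : T → ℝ, (∀ t, 0 ≤ γ t) ∧ (∀ t ∉ A ∩ B, γ t = 0) ∧
      α - γ ∈ Submodule.span ℝ (blockRelation head ch '' J) := by
  classical
  induction J using Finset.induction_on_min_value (fun i => r (head i)) with
  | empty =>
    intro A B _ _ α β hα hβ hA hB h
    have : α = β := by simpa [sub_eq_zero] using h
    subst this
    refine ⟨α, hα, fun t ht => ?_, by simp⟩
    by_cases htA : t ∈ A
    · exact hB t fun h => ht ⟨htA, h⟩
    · exact hA t htA
  | insert i J hi hmin ih =>
    intro A B hAc hBc α β hα hβ hA hB h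
    rw [Finset.coe_insert, Set.image_insert_eq] at h ⊢
    obtain ⟨μ, z, hz, hαβ⟩ := Submodule.mem_span_insert.1 h
    -- A child of the lowest block is neither a head nor a child of a block in `J`, so only block
    -- `i` affects its coordinate.
    have hz0 : ∀ c ∈ ch i, z c = 0 := by
      intro c hc
      have : Submodule.span ℝ (blockRelation head ch '' J) ≤
          LinearMap.ker (LinearMap.proj (R := ℝ) (φ := fun _ : T => ℝ) c) := by
        rw [Submodule.span_le]
        rintro _ ⟨j, hj, rfl⟩
        have h1 : c ≠ head j := by
          rintro rfl
          exact absurd (hr i _ hc) (not_lt.2 (hmin j hj))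
        have h2 : c ∉ ch j := fun h => hi (hdis i j c hc h ▸ hj)
        simp [blockRelation, h1, h2]
      exact this hz
    have hri : ∀ c ∈ ch i, blockRelation head ch i c = -1 := by
      intro c hc
      have h1 : c ≠ head i := by
        rintro rfl
        exact lt_irrefl _ (hr i _ hc)
      simp [blockRelation, h1, hc]
    have hdiff : ∀ c ∈ ch i, β c = α c + μ := by
      intro c hc
      have := congrFun hαβ c
      simp only [Pi.sub_apply, Pi.add_apply, Pi.smul_apply, smul_eq_mul, hri c hc, hz0 c hc] at this
      linarith
    obtain ⟨c₀, hc₀, hc₀min⟩ := (ch i).exists_min_image α (hne i)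
    have hheadch : head i ∉ ch i := fun h => lt_irrefl _ (hr i _ h)
    -- On the block `α` and `β` differ by a constant, so `c₀` minimises both and they have the same
    -- excess `δ`. It is set aside and added back to `γ` at the end.
    let δ : T → ℝ := fun t => if t ∈ ch i then α t - α c₀ else 0
    have hδ : ∀ t, 0 ≤ δ t := by
      intro t
      by_cases ht : t ∈ ch i
      · simpa [δ, ht] using hc₀min t ht
      · simp [δ, ht]
    -- transferring a full block of mass to the head of the block
    have step : ∀ (A : Set T), BlockClosed head ch (insert i J : Finset I) A → ∀ ζ : T → ℝ,
        (∀ t, 0 ≤ ζ t) → (∀ t ∉ A, ζ t = 0) → (∀ c ∈ ch i, δ c = ζ c - ζ c₀) →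
        (∀ t, 0 ≤ (ζ - δ + ζ c₀ • blockRelation head ch i) t) ∧
        (∀ t ∉ A \ (ch i : Set T), (ζ - δ + ζ c₀ • blockRelation head ch i) t = 0) ∧
        BlockClosed head ch J (A \ (ch i : Set T)) ∧ ∀ t ∉ A, δ t = 0 := by
      intro A hAc ζ hζ hζA hζδ
      have hc₀le : ∀ c ∈ ch i, ζ c₀ ≤ ζ c := fun c hc => by
        have := hζδ c hc
        have := hδ c
        linarith
      have hval : ∀ t, (ζ - δ + ζ c₀ • blockRelation head ch i) t =
          if t ∈ ch i then 0 else if t = head i then ζ t + ζ c₀ * (ch i).card else ζ t := by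
        intro t
        by_cases ht : t ∈ ch i
        · simp [hri t ht, ht, hζδ t ht]
        · by_cases hth : t = head i
          · subst hth
            simp [δ, blockRelation, hheadch]
          · simp [δ, blockRelation, ht, hth]
      have hzero : ∀ c ∈ ch i, c ∉ A → ζ c₀ = 0 := fun c hc hcA =>
        le_antisymm ((hc₀le c hc).trans (hζA c hcA).le) (hζ c₀)
      refine ⟨?_, ?_, ?_, ?_⟩
      · intro t
        rw [hval]
        split_ifs
        · exact le_rfl
        · exact add_nonneg (hζ t) (mul_nonneg (hζ _) (Nat.cast_nonneg _))
        · exact hζ t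
      · intro t ht
        rw [hval]
        split_ifs with h1 h2
        · rfl
        · have htA : t ∉ A := fun h => ht ⟨h, h1⟩
          -- If the head is outside `A`, then so is some child; its weight is zero, so the minimum
          -- is zero and nothing is moved.
          have : ∃ c ∈ ch i, c ∉ A := by
            by_contra! hcon
            exact htA (h2 ▸ hAc i (by simp) hcon)
          obtain ⟨c, hc, hcA⟩ := this
          simp [hzero c hc hcA, hζA t htA]
        · exact hζA t fun h => ht ⟨h, h1⟩
      · intro j hj hch
        refine ⟨hAc j (by simp [Finset.mem_coe.1 hj]) fun c hc => (hch c hc).1, fun hmem => ?_⟩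
        exact absurd (hr i _ hmem) (not_lt.2 (hmin j hj))
      · intro t ht
        by_cases htc : t ∈ ch i
        · rw [hζδ t htc, hζA t ht, hzero t htc ht, sub_zero]
        · simp [δ, htc]
    obtain ⟨a1, a2, a3, a4⟩ := step A hAc α hα hA fun c hc => by simp [δ, hc]
    obtain ⟨b1, b2, b3, b4⟩ := step B hBc β hβ hB fun c hc => by
      simp [δ, hc, hdiff c hc, hdiff c₀ hc₀]
    obtain ⟨γ, hγ, hγAB, hγα⟩ := ih _ _ a3 b3 _ _ a1 b1 a2 b2 (by
      convert hz using 1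
      have : z = α - β - μ • blockRelation head ch i := by rw [hαβ]; abel
      rw [this, hdiff c₀ hc₀]
      module)
    refine ⟨γ + δ, fun t => add_nonneg (hγ t) (hδ t), fun t ht => ?_, ?_⟩
    · have h1 : γ t = 0 := hγAB t fun h => ht ⟨h.1.1, h.2.1⟩
      have h2 : δ t = 0 := by
        by_cases htA : t ∈ A
        · exact b4 t fun h => ht ⟨htA, h⟩
        · exact a4 t htA
      simp [h1, h2]
    · refine Submodule.mem_span_insert.2 ⟨-α c₀, _, hγα, ?_⟩
      module

theorem exists_linearMap_euclideanSpace_ker {V : Type u} [AddCommGroup V] [Module ℝ V]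
    [FiniteDimensional ℝ V] (W : Submodule ℝ V) :
    ∃ (n : ℕ) (π : V →ₗ[ℝ] EuclideanSpace ℝ (Fin n)), LinearMap.ker π = W := by
  have e : (V ⧸ W) ≃ₗ[ℝ] EuclideanSpace ℝ (Fin (Module.finrank ℝ (V ⧸ W))) :=
    LinearEquiv.ofFinrankEq _ _ (by simp)
  exact ⟨_, e.toLinearMap ∘ₗ W.mkQ, by rw [LinearEquiv.ker_comp, Submodule.ker_mkQ]⟩

/-- Hull membership becomes existence of nonnegative weights on nodes, unique only up to the kernel
of `π`. -/
theorem mem_convexHull_image_single {E : Type v} [AddCommGroup E] [Module ℝ E] [Fintype T]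
    [DecidableEq T] (π : (T → ℝ) →ₗ[ℝ] E) (A : Set T) (v : E) :
    v ∈ convexHull ℝ ((fun t => π (Pi.single t 1)) '' A) ↔
      ∃ α : T → ℝ, (∀ t, 0 ≤ α t) ∧ (∀ t ∉ A, α t = 0) ∧ ∑ t, α t = 1 ∧ π α = v := by
  constructor
  · intro hv
    have hconv : Convex ℝ {v : E | ∃ α : T → ℝ, (∀ t, 0 ≤ α t) ∧ (∀ t ∉ A, α t = 0) ∧
        ∑ t, α t = 1 ∧ π α = v} := by
      rintro _ ⟨α, h1, h2, h3, rfl⟩ _ ⟨β, k1, k2, k3, rfl⟩ a b ha hb hab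
      refine ⟨a • α + b • β, fun t => ?_, fun t ht => ?_, ?_, by simp⟩
      · exact add_nonneg (mul_nonneg ha (h1 t)) (mul_nonneg hb (k1 t))
      · simp [h2 t ht, k2 t ht]
      · simp [Finset.sum_add_distrib, ← Finset.mul_sum, h3, k3, hab]
    refine convexHull_min ?_ hconv hv
    rintro _ ⟨t, ht, rfl⟩
    refine ⟨Pi.single t 1, fun s => ?_, fun s hs => ?_, by simp, rfl⟩
    · by_cases h : s = t
      · subst h; simp
      · simp [h]
    · have : s ≠ t := by rintro rfl; exact hs ht
      simp [this]
  · rintro ⟨α, h1, h2, h3, rfl⟩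
    classical
    have hsum : π α = ∑ t ∈ Finset.univ.filter (· ∈ A), α t • π (Pi.single t 1) := by
      rw [Finset.sum_filter_of_ne]
      · conv_lhs => rw [pi_eq_sum_univ' α]
        rw [map_sum]
        refine Finset.sum_congr rfl fun t _ => ?_
        rw [map_smul]
      · intro t _ ht
        by_contra h
        simp [h2 t h] at ht
    rw [hsum]
    refine (convex_convexHull ℝ _).sum_mem (fun t _ => h1 t) ?_ fun t ht =>
      subset_convexHull ℝ _ ⟨t, (Finset.mem_filter.1 ht).2, rfl⟩
    rw [Finset.sum_filter_of_ne, h3]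
    intro t _ ht
    by_contra h
    exact ht (h2 t h)

/-- Disjoint blocks of at least two nodes each, whose children have smaller rank than their
heads, are realized by points such that heads are in the convex hull of their children and
intersections of convex hulls of closed sets of nodes are as small as possible. -/
theorem exists_configuration [Finite T] [Finite I] (r : T → ℕ)
    (hr : ∀ i, ∀ c ∈ ch i, r c < r (head i)) (hne : ∀ i, (ch i).Nonempty)
    (hdis : ∀ i j c, c ∈ ch i → c ∈ ch j → i = j) :
    ∃ (n : ℕ) (x : T → EuclideanSpace ℝ (Fin n)),
      (∀ i, x (head i) ∈ convexHull ℝ (x '' (ch i : Set T))) ∧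
      ∀ A B : Set T, BlockClosed head ch Set.univ A → BlockClosed head ch Set.univ B →
        convexHull ℝ (x '' A) ∩ convexHull ℝ (x '' B) ⊆ convexHull ℝ (x '' (A ∩ B)) := by
  classical
  cases nonempty_fintype T
  cases nonempty_fintype I
  obtain ⟨n, π, hπ⟩ := exists_linearMap_euclideanSpace_ker
    (Submodule.span ℝ (blockRelation head ch '' (Finset.univ : Finset I)))
  -- This ensures that the common weighting `γ` again has total mass one.
  have hsumrel : ∀ z ∈ Submodule.span ℝ (blockRelation head ch '' (Finset.univ : Finset I)),
      ∑ t, z t = 0 := by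
    intro z hz
    induction hz using Submodule.span_induction with
    | mem z hz =>
      obtain ⟨i, -, rfl⟩ := hz
      simp [blockRelation, Finset.sum_sub_distrib]
    | zero => simp
    | add y z _ _ hy hz => simp [Finset.sum_add_distrib, hy, hz]
    | smul a z _ hz => simp [← Finset.mul_sum, hz]
  refine ⟨n, fun t => π (Pi.single t 1), fun i => ?_, ?_⟩
  · rw [mem_convexHull_image_single]
    have hcard : ((ch i).card : ℝ) ≠ 0 := by
      simpa using (hne i).ne_empty
    refine ⟨fun t => if t ∈ ch i then ((ch i).card : ℝ)⁻¹ else 0, fun t => ?_, fun t ht => ?_,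
      ?_, ?_⟩
    · dsimp only
      split_ifs <;> positivity
    · exact if_neg ht
    · simp [hcard]
    · have hmem : blockRelation head ch i ∈ LinearMap.ker π := by
        rw [hπ]
        exact Submodule.subset_span ⟨i, by simp, rfl⟩
      have heq : (fun t => if t ∈ ch i then ((ch i).card : ℝ)⁻¹ else 0) =
          Pi.single (head i) 1 - ((ch i).card : ℝ)⁻¹ • blockRelation head ch i := by
        ext t
        by_cases h1 : t = head i <;> by_cases h2 : t ∈ ch i <;>
          simp [blockRelation, h1, h2, hcard, mul_sub]
      rw [heq, map_sub, map_smul, LinearMap.mem_ker.1 hmem, smul_zero, sub_zero]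
  · rintro A B hA hB v ⟨hvA, hvB⟩
    rw [mem_convexHull_image_single] at hvA hvB ⊢
    obtain ⟨α, hα, hαA, hα1, rfl⟩ := hvA
    obtain ⟨β, hβ, hβB, hβ1, hβα⟩ := hvB
    obtain ⟨γ, hγ, hγAB, hγα⟩ := exists_common_combination r hr hne hdis Finset.univ A B
      (by simpa using hA) (by simpa using hB) α β hα hβ hαA hβB
      (by rw [← hπ, LinearMap.mem_ker, map_sub, hβα, sub_self])
    refine ⟨γ, hγ, hγAB, ?_, ?_⟩
    · have := hsumrel _ hγα
      simp only [Pi.sub_apply, Finset.sum_sub_distrib, hα1] at this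
      linarith
    · rw [← hπ, LinearMap.mem_ker, map_sub, sub_eq_zero] at hγα
      exact hγα.symm

end Configuration

/-! ### Unfolding covers into a forest -/

section CoverTree

variable {L : Type u} [Lattice L]

/-- Nodes of trees whose edges choose a set of elements of `L` and a member of it. -/
inductive CoverNode (L : Type u) : Type u
  | root : L → CoverNode L
  | child : CoverNode L → Set L → L → CoverNode L

namespace CoverNode

/-- The element of `L` carried by a node. -/
def label : CoverNode L → L
  | root a => a
  | child _ _ c => c

/-- All chosen sets are minimal nontrivial join covers of the label of the parent node. -/
def Valid : CoverNode L → Prop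
  | root _ => True
  | child t C c => Valid t ∧ IsMinimalCover t.label C ∧ c ∈ C

/-- Ranks are bounded by some `N` and drop from parent to child, so the nodes of rank at least `N -
k` are finite in number, by induction on `k`. -/
theorem finite_setOf_valid [Finite L] {r : L → ℕ}
    (hr : ∀ a C, IsMinimalCover a C → ∀ c ∈ C, r c < r a) : {t : CoverNode L | Valid t}.Finite := by
  obtain ⟨N, hN⟩ := (Set.finite_range r).bddAbove
  have key : ∀ k, {t : CoverNode L | Valid t ∧ N ≤ r t.label + k}.Finite := by
    intro k
    induction k with
    | zero =>
      refine (Set.finite_range (root : L → CoverNode L)).subset ?_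
      rintro (a | ⟨t, C, c⟩) ⟨ht, hle⟩
      · exact ⟨a, rfl⟩
      · have h1 := hr _ _ ht.2.1 c ht.2.2
        have h2 : r t.label ≤ N := hN ⟨_, rfl⟩
        simp only [label] at hle
        lia
    | succ k ih =>
      refine ((Set.finite_range (root : L → CoverNode L)).union
        ((ih.prod (Set.finite_univ (α := Set L × L))).image
          fun p => child p.1 p.2.1 p.2.2)).subset ?_
      rintro (a | ⟨t, C, c⟩) ⟨ht, hle⟩
      · exact Or.inl ⟨a, rfl⟩
      · have h1 := hr _ _ ht.2.1 c ht.2.2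
        simp only [label] at hle
        exact Or.inr ⟨(t, C, c), ⟨⟨ht.1, by lia⟩, trivial⟩, rfl⟩
  exact (key N).subset fun t ht => ⟨ht, Nat.le_add_left _ _⟩

end CoverNode

open CoverNode in
/-- A finite lattice with a rank function that decreases along minimal nontrivial join covers is
the lattice of labels of a finite family of nodes with disjoint blocks. -/
theorem exists_labelled_blocks [Finite L] {r : L → ℕ}
    (hr : ∀ a C, IsMinimalCover a C → ∀ c ∈ C, r c < r a) :
    ∃ (T I : Type u) (_ : Finite T) (_ : Finite I) (head : I → T) (ch : I → Finset T)
      (label : T → L), Function.Surjective label ∧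
      (∀ i, ∀ c ∈ ch i, r (label c) < r (label (head i))) ∧
      (∀ i, ∀ s, ∃ t ∈ ch i, t ≠ s) ∧
      (∀ i j c, c ∈ ch i → c ∈ ch j → i = j) ∧
      (∀ i u, (∀ c ∈ ch i, label c ≤ u) → label (head i) ≤ u) ∧
      ∀ t a b, label t ≤ a ⊔ b → ¬ label t ≤ a → ¬ label t ≤ b →
        ∃ i, head i = t ∧ ∀ c ∈ ch i, label c ≤ a ∨ label c ≤ b := by
  classical
  have hT : Finite {t : CoverNode L // Valid t} := (finite_setOf_valid hr).to_subtype
  cases nonempty_fintype {t : CoverNode L // Valid t}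
  have hmem : ∀ (i : {i : {t : CoverNode L // Valid t} × Set L // IsMinimalCover i.1.1.label i.2})
      (t : {t : CoverNode L // Valid t}),
      t ∈ Finset.univ.filter (fun t : {t : CoverNode L // Valid t} =>
        ∃ c ∈ i.1.2, t.1 = child i.1.1.1 i.1.2 c) ↔ ∃ c ∈ i.1.2, t.1 = child i.1.1.1 i.1.2 c :=
    fun i t => by simp
  refine ⟨{t : CoverNode L // Valid t},
    {i : {t : CoverNode L // Valid t} × Set L // IsMinimalCover i.1.1.label i.2}, hT,
    inferInstance, fun i => i.1.1,
    fun i => Finset.univ.filter fun t => ∃ c ∈ i.1.2, t.1 = child i.1.1.1 i.1.2 c,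
    fun t => t.1.label, fun a => ⟨⟨root a, trivial⟩, rfl⟩, ?_, ?_, ?_, ?_, ?_⟩
  · intro i t ht
    obtain ⟨c, hc, h⟩ := (hmem i t).1 ht
    dsimp only
    rw [h]
    exact hr _ _ i.2 c hc
  · intro i s
    obtain ⟨d, hd, hne⟩ := i.2.exists_ne (c := s.1.label)
    refine ⟨⟨child i.1.1.1 i.1.2 d, i.1.1.2, i.2, hd⟩, (hmem i _).2 ⟨d, hd, rfl⟩, ?_⟩
    rintro rfl
    exact hne rfl
  -- A child node records its parent and the chosen cover, hence determines its block.
  · intro i j t hi hj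
    obtain ⟨c, hc, h⟩ := (hmem i t).1 hi
    obtain ⟨d, hd, h'⟩ := (hmem j t).1 hj
    rw [h] at h'
    injection h' with h1 h2 h3
    exact Subtype.ext (Prod.ext (Subtype.ext h1) h2)
  · intro i u hu
    refine i.2.isCover u fun c hc => ?_
    exact hu ⟨child i.1.1.1 i.1.2 c, i.1.1.2, i.2, hc⟩ ((hmem i _).2 ⟨c, hc, rfl⟩)
  · intro t a b hab ha hb
    obtain ⟨C, hC, hCab⟩ := exists_isMinimalCover hab ha hb
    refine ⟨⟨(t, C), hC⟩, rfl, fun s hs => ?_⟩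
    obtain ⟨c, hc, h⟩ := (hmem ⟨(t, C), hC⟩ s).1 hs
    dsimp only
    rw [h]
    exact hCab c hc

end CoverTree

/-! ### Embeddings into lattices of convex sets -/

section Embedding

variable {T : Type u} {I : Type u} {head : I → T} {ch : I → Finset T} {E : Type v}
  [AddCommGroup E] [Module ℝ E] {x : T → E}

/-- Since no block has a single child, `{t}` is closed. Were `t` outside `A`, the intersection
property would put `x t` in an empty hull. -/
theorem mem_of_mem_convexHull_image (hch : ∀ i, ∀ s, ∃ t ∈ ch i, t ≠ s)
    (hx : ∀ A B : Set T, BlockClosed head ch Set.univ A → BlockClosed head ch Set.univ B →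
      convexHull ℝ (x '' A) ∩ convexHull ℝ (x '' B) ⊆ convexHull ℝ (x '' (A ∩ B)))
    {A : Set T} (hA : BlockClosed head ch Set.univ A) {t : T}
    (ht : x t ∈ convexHull ℝ (x '' A)) : t ∈ A := by
  have hs : BlockClosed head ch Set.univ {t} := by
    intro i _ h
    obtain ⟨s, hs, hne⟩ := hch i t
    exact absurd (h s hs) hne
  have hxt : x t ∈ convexHull ℝ (x '' {t}) := subset_convexHull ℝ _ (Set.mem_image_of_mem x rfl)
  have hmem : x t ∈ convexHull ℝ (x '' (A ∩ {t})) := hx A {t} hA hs (Set.mem_inter ht hxt)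
  by_contra htA
  rw [Set.inter_singleton_eq_empty.2 htA] at hmem
  simp at hmem

/-- The least set of nodes that contains `Z` and is closed under the blocks. -/
inductive BlockClosure (head : I → T) (ch : I → Finset T) (Z : Set T) : T → Prop
  | of_mem (t : T) : t ∈ Z → BlockClosure head ch Z t
  | of_block (i : I) : (∀ c ∈ ch i, BlockClosure head ch Z c) → BlockClosure head ch Z (head i)

/-- Replacing heads by their children repeatedly ends in `Z` and lowers the rank, which supplies the
refined covers needed for the rank criterion. -/
theorem BlockClosure.exists_subset (r : T → ℕ) (hr : ∀ i, ∀ c ∈ ch i, r c < r (head i))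
    (hx : ∀ i, x (head i) ∈ convexHull ℝ (x '' (ch i : Set T))) {Z : Set T} {t : T}
    (h : BlockClosure head ch Z t) :
    t ∈ Z ∨ ∃ S ⊆ Z, (∀ s ∈ S, r s < r t) ∧ x t ∈ convexHull ℝ (x '' S) := by
  induction h with
  | of_mem t ht => exact Or.inl ht
  | of_block i _ ih =>
    refine Or.inr ⟨{s | s ∈ Z ∧ r s < r (head i)}, fun s hs => hs.1, fun s hs => hs.2, ?_⟩
    refine convexHull_min ?_ (convex_convexHull ℝ _) (hx i)
    rintro _ ⟨c, hc, rfl⟩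
    rcases ih c hc with h | ⟨S, hSZ, hS, hcS⟩
    · exact subset_convexHull ℝ _ (Set.mem_image_of_mem x (Set.mem_sep h (hr i c hc)))
    · exact convexHull_mono (Set.image_mono fun s hs =>
        Set.mem_sep (hSZ hs) ((hS s hs).trans (hr i c hc))) hcS

theorem RelCo.mem_iff {X : Set E} (A : RelCo E X) {e : E} :
    e ∈ A.1 ↔ e ∈ convexHull ℝ A.1 ∧ e ∈ X :=
  ⟨fun h => A.2.subset h, fun h => A.2.superset h⟩

theorem isLowerBoundedLattice_relCo [Finite T] (hch : ∀ i, ∀ s, ∃ t ∈ ch i, t ≠ s)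
    (r : T → ℕ) (hr : ∀ i, ∀ c ∈ ch i, r c < r (head i))
    (hx₁ : ∀ i, x (head i) ∈ convexHull ℝ (x '' (ch i : Set T)))
    (hx₂ : ∀ A B : Set T, BlockClosed head ch Set.univ A → BlockClosed head ch Set.univ B →
      convexHull ℝ (x '' A) ∩ convexHull ℝ (x '' B) ⊆ convexHull ℝ (x '' (A ∩ B))) :
    IsLowerBoundedLattice (RelCo E (Set.range x)) := by
  have : Finite (RelCo E (Set.range x)) := by
    refine Finite.of_injective (fun A => x ⁻¹' A.1) ?_
    intro A B h
    refine Subtype.ext ?_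
    rw [← Set.image_preimage_eq_of_subset A.subset, ← Set.image_preimage_eq_of_subset B.subset]
    exact congrArg (x '' ·) h
  have : Nonempty (RelCo E (Set.range x)) := ⟨⟨∅, by simp⟩⟩
  let ι : T → RelCo E (Set.range x) := fun t =>
    ⟨{x t}, by rw [convexHull_singleton]; simp⟩
  have hι : ∀ t (A : RelCo E (Set.range x)), ι t ≤ A ↔ x t ∈ A.1 := fun t A =>
    Set.singleton_subset_iff
  refine isLowerBoundedLattice_of_rank ι r ?_ ?_
  · intro A B h e he
    obtain ⟨t, rfl⟩ := A.subset he
    exact (hι t B).1 (h t ((hι t A).2 he))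
  · intro t A B ht hA hB
    rw [hι] at ht hA hB
    have hAB : x t ∈ convexHull ℝ (A.1 ∪ B.1) := ht.1
    have hZ : A.1 ∪ B.1 = x '' (x ⁻¹' (A.1 ∪ B.1)) :=
      (Set.image_preimage_eq_of_subset (Set.union_subset A.subset B.subset)).symm
    -- Passing to the block closure costs nothing: it is closed, so its hull contains `x t` only if
    -- it contains `t`.
    have hcl : BlockClosure head ch (x ⁻¹' (A.1 ∪ B.1)) t := by
      refine mem_of_mem_convexHull_image hch hx₂
        (A := {t | BlockClosure head ch (x ⁻¹' (A.1 ∪ B.1)) t})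
        (fun i _ h => BlockClosure.of_block i h) ?_
      rw [hZ] at hAB
      exact convexHull_mono (Set.image_mono fun s hs => BlockClosure.of_mem s hs) hAB
    rcases hcl.exists_subset r hr hx₁ with h | ⟨S, hSZ, hS, htS⟩
    · exact absurd h (not_or.2 ⟨hA, hB⟩)
    · refine ⟨S, fun s hs => ⟨hS s hs, ?_⟩, fun U hU => ?_⟩
      · rw [hι, hι]
        exact hSZ hs
      · rw [hι, RelCo.mem_iff]
        refine ⟨convexHull_mono ?_ htS, t, rfl⟩
        rintro _ ⟨s, hs, rfl⟩
        exact (hι s U).1 (hU s hs)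

variable {L : Type u} [Lattice L] {label : T → L}

theorem blockClosed_setOf_label_le
    (hlab : ∀ i u, (∀ c ∈ ch i, label c ≤ u) → label (head i) ≤ u) (a : L) :
    BlockClosed head ch Set.univ {t | label t ≤ a} :=
  fun i _ h => hlab i a h

theorem mem_convexHull_union_of_label_le
    (hcov : ∀ t a b, label t ≤ a ⊔ b → ¬ label t ≤ a → ¬ label t ≤ b →
      ∃ i, head i = t ∧ ∀ c ∈ ch i, label c ≤ a ∨ label c ≤ b)
    (hx : ∀ i, x (head i) ∈ convexHull ℝ (x '' (ch i : Set T))) {a b : L} {t : T}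
    (ht : label t ≤ a ⊔ b) :
    x t ∈ convexHull ℝ (x '' {t | label t ≤ a} ∪ x '' {t | label t ≤ b}) := by
  by_cases ha : label t ≤ a
  · exact subset_convexHull ℝ _ (Or.inl ⟨t, ha, rfl⟩)
  by_cases hb : label t ≤ b
  · exact subset_convexHull ℝ _ (Or.inr ⟨t, hb, rfl⟩)
  obtain ⟨i, rfl, hi⟩ := hcov t a b ht ha hb
  refine convexHull_mono ?_ (hx i)
  rintro _ ⟨c, hc, rfl⟩
  exact (hi c hc).imp (fun h => ⟨c, h, rfl⟩) fun h => ⟨c, h, rfl⟩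

theorem le_of_convexHull_subset (hsurj : Function.Surjective label)
    (hch : ∀ i, ∀ s, ∃ t ∈ ch i, t ≠ s)
    (hx : ∀ A B : Set T, BlockClosed head ch Set.univ A → BlockClosed head ch Set.univ B →
      convexHull ℝ (x '' A) ∩ convexHull ℝ (x '' B) ⊆ convexHull ℝ (x '' (A ∩ B)))
    (hlab : ∀ i u, (∀ c ∈ ch i, label c ≤ u) → label (head i) ≤ u) {a b : L}
    (h : x '' {t | label t ≤ a} ⊆ convexHull ℝ (x '' {t | label t ≤ b})) : a ≤ b := by
  obtain ⟨t, rfl⟩ := hsurj a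
  exact mem_of_mem_convexHull_image hch hx (blockClosed_setOf_label_le hlab b)
    (h ⟨t, le_rfl, rfl⟩)

theorem latticeEmbeds_co (hsurj : Function.Surjective label)
    (hch : ∀ i, ∀ s, ∃ t ∈ ch i, t ≠ s)
    (hlab : ∀ i u, (∀ c ∈ ch i, label c ≤ u) → label (head i) ≤ u)
    (hcov : ∀ t a b, label t ≤ a ⊔ b → ¬ label t ≤ a → ¬ label t ≤ b →
      ∃ i, head i = t ∧ ∀ c ∈ ch i, label c ≤ a ∨ label c ≤ b)
    (hx₁ : ∀ i, x (head i) ∈ convexHull ℝ (x '' (ch i : Set T)))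
    (hx₂ : ∀ A B : Set T, BlockClosed head ch Set.univ A → BlockClosed head ch Set.univ B →
      convexHull ℝ (x '' A) ∩ convexHull ℝ (x '' B) ⊆ convexHull ℝ (x '' (A ∩ B))) :
    LatticeEmbeds L (Co E) := by
  let φ : L → Co E := fun a => ⟨convexHull ℝ (x '' {t | label t ≤ a}), convex_convexHull ℝ _⟩
  have hmono : Monotone φ := fun a b hab =>
    convexHull_mono (Set.image_mono fun t ht => le_trans ht hab)
  refine ⟨⟨⟨φ, fun a b => le_antisymm ?_ (hmono.le_map_sup a b)⟩,
    fun a b => le_antisymm (hmono.map_inf_le a b) ?_⟩, fun a b h => ?_⟩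
  · refine convexHull_min ?_ (convex_convexHull ℝ _)
    rintro _ ⟨t, ht, rfl⟩
    exact convexHull_mono (Set.union_subset_union (subset_convexHull ℝ _) (subset_convexHull ℝ _))
      (mem_convexHull_union_of_label_le hcov hx₁ ht)
  · refine (hx₂ _ _ (blockClosed_setOf_label_le hlab a)
      (blockClosed_setOf_label_le hlab b)).trans (convexHull_mono (Set.image_mono ?_))
    exact fun t ht => le_inf ht.1 ht.2
  · have h' : convexHull ℝ (x '' {t | label t ≤ a}) = convexHull ℝ (x '' {t | label t ≤ b}) :=
      congrArg Subtype.val h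
    exact le_antisymm
      (le_of_convexHull_subset hsurj hch hx₂ hlab (h' ▸ subset_convexHull ℝ _))
      (le_of_convexHull_subset hsurj hch hx₂ hlab (h' ▸ subset_convexHull ℝ _))

theorem latticeEmbeds_relCo (hsurj : Function.Surjective label)
    (hch : ∀ i, ∀ s, ∃ t ∈ ch i, t ≠ s)
    (hlab : ∀ i u, (∀ c ∈ ch i, label c ≤ u) → label (head i) ≤ u)
    (hcov : ∀ t a b, label t ≤ a ⊔ b → ¬ label t ≤ a → ¬ label t ≤ b →
      ∃ i, head i = t ∧ ∀ c ∈ ch i, label c ≤ a ∨ label c ≤ b)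
    (hx₁ : ∀ i, x (head i) ∈ convexHull ℝ (x '' (ch i : Set T)))
    (hx₂ : ∀ A B : Set T, BlockClosed head ch Set.univ A → BlockClosed head ch Set.univ B →
      convexHull ℝ (x '' A) ∩ convexHull ℝ (x '' B) ⊆ convexHull ℝ (x '' (A ∩ B))) :
    LatticeEmbeds L (RelCo E (Set.range x)) := by
  have hmem : ∀ a t, x t ∈ convexHull ℝ (x '' {t | label t ≤ a}) → label t ≤ a := fun a t h =>
    mem_of_mem_convexHull_image hch hx₂ (blockClosed_setOf_label_le hlab a) h
  let φ : L → RelCo E (Set.range x) := fun a => ⟨x '' {t | label t ≤ a}, by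
    apply Set.Subset.antisymm
    · exact Set.subset_inter (subset_convexHull ℝ _) (Set.image_subset_range _ _)
    · rintro _ ⟨h, t, rfl⟩
      exact ⟨t, hmem a t h, rfl⟩⟩
  have hmono : Monotone φ := fun a b hab => Set.image_mono fun t ht => le_trans ht hab
  refine ⟨⟨⟨φ, fun a b => le_antisymm ?_ (hmono.le_map_sup a b)⟩,
    fun a b => le_antisymm (hmono.map_inf_le a b) ?_⟩, fun a b h => ?_⟩
  · rintro _ ⟨t, ht, rfl⟩
    exact ⟨mem_convexHull_union_of_label_le hcov hx₁ ht, t, rfl⟩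
  · rintro _ ⟨⟨t, ht, rfl⟩, hb⟩
    exact ⟨t, le_inf ht (hmem b t (subset_convexHull ℝ _ hb)), rfl⟩
  · have h' : x '' {t | label t ≤ a} = x '' {t | label t ≤ b} := congrArg Subtype.val h
    exact le_antisymm
      (le_of_convexHull_subset hsurj hch hx₂ hlab (h' ▸ subset_convexHull ℝ _))
      (le_of_convexHull_subset hsurj hch hx₂ hlab (h' ▸ subset_convexHull ℝ _))

end Embedding

theorem mainTheorem2 {L : Type*} [Lattice L] [Finite L] (hL : IsLowerBoundedLattice L) :
    ∃ (n : ℕ) (X : Set (EuclideanSpace ℝ (Fin n))),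
      X.Finite ∧
      IsLowerBoundedLattice (RelCo (EuclideanSpace ℝ (Fin n)) X) ∧
      LatticeEmbeds L (Co (EuclideanSpace ℝ (Fin n))) ∧
      LatticeEmbeds L (RelCo (EuclideanSpace ℝ (Fin n)) X) := by
  obtain ⟨r, hr⟩ := hL.exists_rank
  obtain ⟨T, I, _, _, head, ch, label, hsurj, hrank, hch, hdis, hlab, hcov⟩ :=
    exists_labelled_blocks hr
  obtain ⟨n, x, hx₁, hx₂⟩ := exists_configuration (fun t => r (label t)) hrank
    (fun i => let ⟨t, ht, _⟩ := hch i (head i); ⟨t, ht⟩) hdis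
  exact ⟨n, Set.range x, Set.finite_range x,
    isLowerBoundedLattice_relCo hch (fun t => r (label t)) hrank hx₁ hx₂,
    latticeEmbeds_co hsurj hch hlab hcov hx₁ hx₂,
    latticeEmbeds_relCo hsurj hch hlab hcov hx₁ hx₂⟩
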